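/- Let $\tau_0(x)=x/4$ and $\tau_2(x)=(x+2)/4$ on $\mathbb{R}$, and let $\mu$ be the unique Borel probability measure on $\mathbb{R}$ with $$\mu(E)=\tfrac12\left(\mu(\tau_0^{-1}E)+\mu(\tau_2^{-1}E)\right)\quad\text{for all Borel sets }E\subseteq\mathbb{R}.$$ Equivalently, $\mu$ is the law of $\sum_{k\ge1}b_k4^{-k}$ where the digits $b_k$ are independent and equal to $0$ or $2$ with probability $\tfrac12$ each. For $\gamma\in\mathbb{R}$ put $e_\gamma(x)=e^{2\pi i\gamma x}$. For an odd positive integer $m$ put $$\Gamma(m)=\left\{\sum_{k=0}^{n}4^k l_k \;:\; n\in\mathbb{N},\ l_k\in\{0,m\}\right\},$$ and call $m$ complete if $\{e_\gamma:\gamma\in\Gamma(m)\}$ is an orthonormal basis (Hilbert basis) of the complex Hilbert space $L^2(\mu)$. Theorem. If $p$ is a prime number with $p>3$ and $n\ge0$ is an integer, then $p^n$ is complete. -/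

import Mathlib

open MeasureTheory
open scoped ENNReal BigOperators

noncomputable section

namespace CantorSpectra

/-- The contraction `x ↦ x / 4`. -/
def tau0 (x : ℝ) : ℝ := x / 4

/-- The contraction `x ↦ (x + 2) / 4`. -/
def tau2 (x : ℝ) : ℝ := (x + 2) / 4

/-- `ν` is an invariant measure of the iterated function system `{tau0, tau2}`: a Borel probability
measure on `ℝ` with `ν E = (ν (tau0 ⁻¹ E) + ν (tau2 ⁻¹ E)) / 2` for all Borel sets `E`. -/
def IsInvariant (ν : Measure ℝ) : Prop :=
  IsProbabilityMeasure ν ∧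
    ∀ E : Set ℝ, MeasurableSet E → ν E = 2⁻¹ * (ν (tau0 ⁻¹' E) + ν (tau2 ⁻¹' E))

/-- The law of one fair coin toss. -/
def coin : Measure Bool :=
  (2⁻¹ : ℝ≥0∞) • Measure.dirac false + (2⁻¹ : ℝ≥0∞) • Measure.dirac true

/-- The digit `0` or `2` that belongs to the result of a coin toss. -/
def digit (b : Bool) : ℝ := if b then 2 else 0

/-- The real number `∑ b_k / 4 ^ k` (sum over `k ≥ 1`) with digits `b_k ∈ {0, 2}`. -/
def expansion (ω : ℕ → Bool) : ℝ := ∑' k : ℕ, digit (ω k) / 4 ^ (k + 1)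

instance : IsProbabilityMeasure coin := by
  constructor
  simp [coin, ENNReal.inv_two_add_inv_two]

/-- The measure `μ` on the Cantor set of all `∑ b_k / 4 ^ k` with `b_k ∈ {0, 2}`: the law of that sum
for independent digits that are `0` or `2` with probability one half each. It is the unique
invariant measure of the system `{tau0, tau2}`, see `isInvariant_iff`. -/
def cantorMeasure : Measure ℝ := (Measure.infinitePi (fun _ : ℕ => coin)).map expansion

lemma digit_nonneg (b : Bool) : 0 ≤ digit b := by
  cases b <;> simp [digit]

lemma digit_le (b : Bool) : digit b ≤ 2 := by
  cases b <;> simp [digit]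

lemma summable_expansion (ω : ℕ → Bool) :
    Summable (fun k : ℕ => digit (ω k) / 4 ^ (k + 1)) := by
  have h : Summable (fun k : ℕ => (1 / 2 : ℝ) * (1 / 4) ^ k) :=
    (summable_geometric_of_lt_one (by norm_num) (by norm_num)).mul_left _
  refine Summable.of_nonneg_of_le (fun k => ?_) (fun k => ?_) h
  · exact div_nonneg (digit_nonneg _) (by positivity)
  · have h4 : (0 : ℝ) < 4 ^ k := by positivity
    rw [div_pow, one_pow, pow_succ, div_le_iff₀ (by positivity)]
    have := digit_le (ω k)
    field_simp
    linarith

lemma measurable_expansion : Measurable expansion := by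
  unfold expansion
  refine Measurable.tsum (fun k => ?_)
  have : Measurable digit := measurable_of_finite _
  exact (this.comp (measurable_pi_apply k)).div_const _

instance : IsProbabilityMeasure cantorMeasure :=
  Measure.isProbabilityMeasure_map measurable_expansion.aemeasurable

/-- Put the toss `b` in front of the sequence `ω`. -/
def cons (b : Bool) (ω : ℕ → Bool) : ℕ → Bool
  | 0 => b
  | k + 1 => ω k

lemma measurable_cons (b : Bool) : Measurable (cons b) := by
  refine measurable_pi_lambda _ (fun k => ?_)
  cases k with
  | zero => exact measurable_const
  | succ k => exact measurable_pi_apply k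

lemma expansion_cons (b : Bool) (ω : ℕ → Bool) :
    expansion (cons b ω) = (expansion ω + digit b) / 4 := by
  have h := (summable_expansion (cons b ω)).tsum_eq_zero_add
  rw [expansion, h, expansion]
  simp only [cons]
  rw [add_div, ← tsum_div_const, add_comm]
  congr 1
  · refine tsum_congr (fun k => ?_)
    rw [pow_succ (4 : ℝ) (k + 1), div_div]
  · norm_num

lemma infinitePi_coin_eq :
    (2⁻¹ : ℝ≥0∞) • (Measure.infinitePi (fun _ : ℕ => coin)).map (cons false) +
      (2⁻¹ : ℝ≥0∞) • (Measure.infinitePi (fun _ : ℕ => coin)).map (cons true) =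
    Measure.infinitePi (fun _ : ℕ => coin) := by
  classical
  refine Measure.eq_infinitePi _ (fun s t ht => ?_)
  obtain ⟨N, hN⟩ : ∃ N, s ⊆ Finset.range (N + 1) :=
    ⟨s.sup id, fun i hi => Finset.mem_range.2
      (Nat.lt_succ_of_le (Finset.le_sup (f := id) hi))⟩
  set t' : ℕ → Set Bool := fun i => if i ∈ s then t i else Set.univ with ht'
  have h1 : Set.pi (s : Set ℕ) t = Set.pi (Finset.range (N + 1) : Set ℕ) t' := by
    ext ω
    simp only [Set.mem_pi, ht', Finset.mem_coe]
    constructor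
    · intro h i _
      split_ifs with hi
      · exact h i hi
      · trivial
    · intro h i hi
      simpa [hi] using h i (hN hi)
  have h2 : ∏ i ∈ s, coin (t i) = ∏ i ∈ Finset.range (N + 1), coin (t' i) := by
    rw [← Finset.prod_subset hN (f := fun i => coin (t' i))]
    · exact Finset.prod_congr rfl (fun i hi => by simp [ht', hi])
    · intro i _ hi
      simp only [ht', hi, if_false, measure_univ]
  have h3 : ∀ b : Bool, cons b ⁻¹' Set.pi (Finset.range (N + 1) : Set ℕ) t' =
      if b ∈ t' 0 then Set.pi (Finset.range N : Set ℕ) (fun i => t' (i + 1)) else ∅ := by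
    intro b
    ext ω
    split_ifs with hb
    · simp only [Set.mem_preimage, Set.mem_pi, Finset.coe_range, Set.mem_Iio]
      constructor
      · intro h i hi
        exact h (i + 1) (by omega)
      · intro h i hi
        cases i with
        | zero => exact hb
        | succ i => exact h i (by omega)
    · simp only [Set.mem_preimage, Set.mem_pi, Finset.coe_range, Set.mem_Iio,
        Set.mem_empty_iff_false, iff_false]
      exact fun h => hb (h 0 (by omega))
  have hm : MeasurableSet (Set.pi (Finset.range (N + 1) : Set ℕ) t') :=
    MeasurableSet.pi (Finset.countable_toSet _) (fun i _ => (Set.toFinite _).measurableSet)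
  have h4 : Measure.infinitePi (fun _ : ℕ => coin)
      (Set.pi (Finset.range N : Set ℕ) (fun i => t' (i + 1))) =
      ∏ i ∈ Finset.range N, coin (t' (i + 1)) :=
    Measure.infinitePi_pi _ (fun i _ => (Set.toFinite _).measurableSet)
  rw [h1, h2, Finset.prod_range_succ', Measure.add_apply, Measure.smul_apply, Measure.smul_apply,
    Measure.map_apply (measurable_cons _) hm, Measure.map_apply (measurable_cons _) hm, h3, h3,
    ← h4]
  simp only [coin, Measure.add_apply, Measure.smul_apply, smul_eq_mul,
    Measure.dirac_apply' _ (Set.toFinite (t' 0)).measurableSet]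
  by_cases hf : false ∈ t' 0 <;> by_cases htr : true ∈ t' 0 <;>
    simp [hf, htr] <;> ring

lemma isInvariant_cantorMeasure : IsInvariant cantorMeasure := by
  refine ⟨inferInstance, fun E hE => ?_⟩
  have h0 : Measurable tau0 := by unfold tau0; fun_prop
  have h2 : Measurable tau2 := by unfold tau2; fun_prop
  have e0 : ∀ ω, expansion (cons false ω) = tau0 (expansion ω) := fun ω => by
    simp [expansion_cons, tau0, digit]
  have e2 : ∀ ω, expansion (cons true ω) = tau2 (expansion ω) := fun ω => by
    simp [expansion_cons, tau2, digit]
  have hpre := measurable_expansion hE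
  unfold cantorMeasure
  rw [Measure.map_apply measurable_expansion hE,
    Measure.map_apply measurable_expansion (h0 hE),
    Measure.map_apply measurable_expansion (h2 hE)]
  conv_lhs => rw [← infinitePi_coin_eq]
  rw [Measure.add_apply, Measure.smul_apply, Measure.smul_apply,
    Measure.map_apply (measurable_cons _) hpre, Measure.map_apply (measurable_cons _) hpre,
    smul_eq_mul, smul_eq_mul, mul_add]
  simp only [Set.preimage_preimage, e0, e2]

lemma IsInvariant.eq_add {ν : Measure ℝ} (h : IsInvariant ν) :
    ν = (2⁻¹ : ℝ≥0∞) • (ν.map tau0 + ν.map tau2) := by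
  have h0 : Measurable tau0 := by unfold tau0; fun_prop
  have h2 : Measurable tau2 := by unfold tau2; fun_prop
  ext E hE
  rw [h.2 E hE, Measure.smul_apply, Measure.add_apply, Measure.map_apply h0 hE,
    Measure.map_apply h2 hE, smul_eq_mul]

lemma IsInvariant.charFun_eq {ν : Measure ℝ} (h : IsInvariant ν) (t : ℝ) :
    charFun ν t =
      (1 + Complex.exp ((t / 2 : ℝ) * Complex.I)) / 2 * charFun ν (t / 4) := by
  have := h.1
  have h0 : Measurable tau0 := by unfold tau0; fun_prop
  have h2 : Measurable tau2 := by unfold tau2; fun_prop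
  have := Measure.isProbabilityMeasure_map (μ := ν) h0.aemeasurable
  have := Measure.isProbabilityMeasure_map (μ := ν) h2.aemeasurable
  have hi : ∀ (m : Measure ℝ) [IsProbabilityMeasure m],
      Integrable (fun x : ℝ => Complex.exp (t * x * Complex.I)) m := by
    intro m _
    refine Integrable.of_bound (C := 1) (by fun_prop) (Filter.Eventually.of_forall fun x => ?_)
    rw [← Complex.ofReal_mul, Complex.norm_exp_ofReal_mul_I]
  conv_lhs => rw [h.eq_add]
  rw [charFun_apply_real, integral_smul_measure, integral_add_measure (hi _) (hi _),
    integral_map h0.aemeasurable (by fun_prop), integral_map h2.aemeasurable (by fun_prop),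
    charFun_apply_real]
  have e0 : ∀ x : ℝ, Complex.exp (t * (tau0 x : ℝ) * Complex.I) =
      Complex.exp ((t / 4 : ℝ) * x * Complex.I) := fun x => by
    congr 1; simp only [tau0]; push_cast; ring
  have e2 : ∀ x : ℝ, Complex.exp (t * (tau2 x : ℝ) * Complex.I) =
      Complex.exp ((t / 2 : ℝ) * Complex.I) * Complex.exp ((t / 4 : ℝ) * x * Complex.I) :=
    fun x => by
      rw [← Complex.exp_add]; congr 1; simp only [tau2]; push_cast; ring
  simp only [e0, e2]
  rw [integral_const_mul, Complex.real_smul, ENNReal.toReal_inv]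
  push_cast [ENNReal.toReal_ofNat]
  ring

/-- The measure above is the unique invariant Borel probability measure. -/
theorem isInvariant_iff {ν : Measure ℝ} : IsInvariant ν ↔ ν = cantorMeasure := by
  refine ⟨fun h => ?_, fun h => h ▸ isInvariant_cantorMeasure⟩
  have := h.1
  refine Measure.ext_of_charFun (funext fun t => ?_)
  have key : ∀ (n : ℕ) (t : ℝ), ‖charFun ν t - charFun cantorMeasure t‖ ≤
      ‖charFun ν (t * (1 / 4) ^ n) - charFun cantorMeasure (t * (1 / 4) ^ n)‖ := by
    intro n
    induction n with
    | zero => intro t; simp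
    | succ n ih =>
      intro t
      have hc : ‖(1 + Complex.exp ((t / 2 : ℝ) * Complex.I)) / 2‖ ≤ 1 := by
        have := norm_add_le (1 : ℂ) (Complex.exp ((t / 2 : ℝ) * Complex.I))
        rw [Complex.norm_exp_ofReal_mul_I, norm_one] at this
        rw [norm_div, Complex.norm_ofNat]
        linarith
      rw [h.charFun_eq t, isInvariant_cantorMeasure.charFun_eq t, ← mul_sub, norm_mul]
      refine (mul_le_of_le_one_left (norm_nonneg _) hc).trans ((ih (t / 4)).trans_eq ?_)
      rw [show t / 4 * (1 / 4) ^ n = t * (1 / 4) ^ (n + 1) by ring]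
  have hlim : Filter.Tendsto (fun n : ℕ =>
      ‖charFun ν (t * (1 / 4) ^ n) - charFun cantorMeasure (t * (1 / 4) ^ n)‖)
      Filter.atTop (nhds 0) := by
    have hp : Filter.Tendsto (fun n : ℕ => t * (1 / 4 : ℝ) ^ n) Filter.atTop (nhds 0) := by
      simpa using (tendsto_pow_atTop_nhds_zero_of_lt_one (r := (1 / 4 : ℝ))
        (by norm_num) (by norm_num)).const_mul t
    have hcont : Continuous (fun x : ℝ => ‖charFun ν x - charFun cantorMeasure x‖) :=
      (continuous_charFun.sub continuous_charFun).norm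
    have := (hcont.tendsto 0).comp hp
    simpa only [Function.comp_def, charFun_zero, probReal_univ, sub_self, norm_zero] using this
  have := ge_of_tendsto' hlim (fun n => key n t)
  exact sub_eq_zero.1 (norm_le_zero_iff.1 this)

/-- The exponential function `e_γ(x) = exp (2 π i γ x)`. -/
def expFun (γ : ℝ) (x : ℝ) : ℂ := Complex.exp (2 * Real.pi * Complex.I * γ * x)

/-- `Γ` is a spectrum for `ν`: the family `(e_γ)`, `γ ∈ Γ`, is an orthonormal (Hilbert) basis of
the complex Hilbert space `L²(ν)`. -/
def IsSpectrum (Γ : Set ℝ) (ν : Measure ℝ) : Prop :=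
  ∃ b : HilbertBasis Γ ℂ (Lp ℂ 2 ν), ∀ γ : Γ, (b γ : ℝ → ℂ) =ᵐ[ν] expFun γ

/-- `Γ(m)`: all sums `∑_{k=0}^n 4 ^ k * l_k` with `n ∈ ℕ` and digits `l_k ∈ {0, m}`. -/
def spectrumSet (m : ℕ) : Set ℝ :=
  {x | ∃ (n : ℕ) (l : ℕ → ℝ), (∀ k, l k = 0 ∨ l k = m) ∧
    x = ∑ k ∈ Finset.range (n + 1), 4 ^ k * l k}

/-- An odd natural number `m` is complete if `Γ(m)` is a spectrum for `cantorMeasure`. -/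
def IsCompleteNumber (m : ℕ) : Prop :=
  Odd m ∧ IsSpectrum (spectrumSet m) cantorMeasure

end CantorSpectra

end

noncomputable section

namespace CantorSpectra

/-! ### Arithmetic of the powers of `4` modulo a prime power -/

/-! Let `H t` be the squared norm of the projection of `e_{-t}` to the closed span of the
exponentials of `Γ(m)`. These are orthonormal for odd `m`, so `H t` is the sum of `|μ̂(t + γ)|²`
over `γ ∈ Γ(m)`. Always `H ≤ 1 = H 0`, and completeness amounts to `H = 1` everywhere, because all
the `e_t` together are total. Self-similarity of `μ` and `Γ(m) = 4Γ(m) ⊔ (4Γ(m) + m)` give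
(`projNormSq_eq`) `H t = cos²(πt/2) H(t/4) + sin²(πt/2) H((t + m)/4)`.

Both maps `t/4` and `(t + m)/4` preserve `[0, m/3]`. If `H` has infinitely many minimizers there, it
is constant by analyticity. Suppose there are finitely many. A child of a minimizer with nonzero
weight is again a minimizer, and the images of the two maps are disjoint, so counting leaves each
minimizer exactly one child among the minimizers. Hence one weight vanishes and every minimizer is
an integer (`zero_mem_of_finite_minimizers`). Along these integers `4y ≡ x` modulo `m`; a power of
`4` congruent to `2`, `-1` or `-2` then forces `0` to be a minimizer (`zero_mem_of_successors`). As
`H 0` is also the maximum, `H` is constant on the interval, contradicting finiteness. For prime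
powers the required power of `4` comes from the order of `2` (`exists_four_pow_modEq`). -/

/-- An odd `p` cannot divide both factors of `(a - 1)(a + 1)`, since they differ by `2`; the whole
power `p ^ n` therefore divides one of them. -/
lemma dvd_sub_one_or_dvd_add_one_of_dvd_sq_sub_one {p : ℕ} (hp : p.Prime) (hp2 : 2 < p)
    {n : ℕ} {a : ℤ} (ha : ((p ^ n : ℕ) : ℤ) ∣ a ^ 2 - 1) :
    ((p ^ n : ℕ) : ℤ) ∣ a - 1 ∨ ((p ^ n : ℕ) : ℤ) ∣ a + 1 := by
  have hpz : Prime (p : ℤ) := Nat.prime_iff_prime_int.1 hp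
  have hfac : ((p ^ n : ℕ) : ℤ) ∣ (a - 1) * (a + 1) := by
    convert ha using 1; ring
  by_cases h : (p : ℤ) ∣ a - 1
  · have h' : ¬ (p : ℤ) ∣ a + 1 := fun h' => by
      have h2 : (p : ℤ) ∣ 2 := by
        have := dvd_sub h' h
        ring_nf at this
        exact this
      have := Int.le_of_dvd (by norm_num) h2
      omega
    left
    push_cast at hfac ⊢
    exact (IsCoprime.pow_left ((Prime.coprime_iff_not_dvd hpz).2 h')).dvd_of_dvd_mul_right hfac
  · right
    push_cast at hfac ⊢
    exact (IsCoprime.pow_left ((Prime.coprime_iff_not_dvd hpz).2 h)).dvd_of_dvd_mul_left hfac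

/-- Modulo a power of an odd prime, some power of `4` is congruent to `2`, `-1` or `-2`. -/
lemma exists_four_pow_modEq {p : ℕ} (hp : p.Prime) (hp2 : 2 < p) (n : ℕ) :
    ∃ j : ℕ, ((p ^ n : ℕ) : ℤ) ∣ 4 ^ j - 2 ∨ ((p ^ n : ℕ) : ℤ) ∣ 4 ^ j + 1 ∨
      ((p ^ n : ℕ) : ℤ) ∣ 4 ^ j + 2 := by
  set m : ℕ := p ^ n with hm
  have hpos : 0 < m := pow_pos hp.pos n
  have : NeZero m := ⟨hpos.ne'⟩
  have hcop : Nat.Coprime 2 m := by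
    refine Nat.Coprime.pow_right n ((Nat.coprime_primes Nat.prime_two hp).2 (by omega))
  set u : (ZMod m)ˣ := ZMod.unitOfCoprime 2 hcop with hu
  have huv : (u : ZMod m) = 2 := by simp [hu, ZMod.coe_unitOfCoprime]
  set d := orderOf u with hd
  have hd0 : 0 < d := orderOf_pos u
  have hpow : ∀ k, u ^ k = 1 ↔ (m : ℤ) ∣ 2 ^ k - 1 := fun k => by
    rw [← ZMod.intCast_zmod_eq_zero_iff_dvd, Units.ext_iff, Units.val_pow_eq_pow_val, huv]
    push_cast
    rw [sub_eq_zero]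
  have hone : (m : ℤ) ∣ 2 ^ d - 1 := (hpow d).1 (pow_orderOf_eq_one u)
  -- If `d = 2e + 1`, then `4 ^ (e + 1) = 2 * 2 ^ d ≡ 2`. If `d = 2e`, then `2 ^ e` is a square root
  -- of `1` other than `1` by minimality of `d`, so it is `-1`. According to the parity of `e`,
  -- either `2 ^ e` is itself a power of `4`, or `2 * 2 ^ e ≡ -2` is one.
  rcases Nat.even_or_odd d with ⟨e, he⟩ | ⟨e, he⟩
  · have hneg : (m : ℤ) ∣ 2 ^ e + 1 := by
      refine (dvd_sub_one_or_dvd_add_one_of_dvd_sq_sub_one hp hp2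
        (a := 2 ^ e) ?_).resolve_left fun h => ?_
      · rw [← pow_mul, mul_two, ← he]; exact hone
      · have := orderOf_le_of_pow_eq_one (by omega) ((hpow e).2 h)
        omega
    rcases Nat.even_or_odd e with ⟨f, hf⟩ | ⟨f, hf⟩
    · refine ⟨f, Or.inr (Or.inl ?_)⟩
      rw [show (4 : ℤ) = 2 ^ 2 by norm_num, ← pow_mul, two_mul, ← hf]
      exact hneg
    · refine ⟨f + 1, Or.inr (Or.inr ?_)⟩
      have : (4 : ℤ) ^ (f + 1) + 2 = 2 * (2 ^ e + 1) := by
        rw [show (4 : ℤ) = 2 ^ 2 by norm_num, ← pow_mul, hf]; ring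
      rw [this]
      exact hneg.mul_left 2
  · refine ⟨e + 1, Or.inl ?_⟩
    have : (4 : ℤ) ^ (e + 1) - 2 = 2 * (2 ^ d - 1) := by
      rw [show (4 : ℤ) = 2 ^ 2 by norm_num, ← pow_mul, he]; ring
    rw [this]
    exact hone.mul_left 2

/-- A nonempty set of integers in `[0, m / 3]`, each element `x` of which has a successor `y` in the
set with `4 y = x` or `4 y = x + m`, contains `0`. -/
lemma zero_mem_of_successors {m : ℕ} (h3 : ¬ 3 ∣ m)
    (hj : ∃ j : ℕ, (m : ℤ) ∣ 4 ^ j - 2 ∨ (m : ℤ) ∣ 4 ^ j + 1 ∨ (m : ℤ) ∣ 4 ^ j + 2)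
    {S : Set ℕ} (hne : S.Nonempty) (hle : ∀ x ∈ S, 3 * x ≤ m)
    (hS : ∀ x ∈ S, ∃ y ∈ S, 4 * y = x ∨ 4 * y = x + m) : 0 ∈ S := by
  have hiter : ∀ (j : ℕ), ∀ x ∈ S, ∃ y ∈ S, (m : ℤ) ∣ 4 ^ j * y - x := by
    intro j
    induction j with
    | zero => exact fun x hx => ⟨x, hx, by simp⟩
    | succ j ih =>
      intro x hx
      obtain ⟨y, hy, hyx⟩ := ih x hx
      obtain ⟨z, hz, hzy⟩ := hS y hy
      refine ⟨z, hz, ?_⟩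
      have h1 : (m : ℤ) ∣ 4 * z - y := by
        rcases hzy with h | h
        · exact ⟨0, by omega⟩
        · exact ⟨1, by omega⟩
      have : (4 : ℤ) ^ (j + 1) * z - x = 4 ^ j * (4 * z - y) + (4 ^ j * y - x) := by ring
      rw [this]
      exact dvd_add (h1.mul_left _) hyx
  have hm : 0 < m := Nat.pos_of_ne_zero fun h => h3 (h ▸ dvd_zero 3)
  obtain ⟨j, hj⟩ := hj
  classical
  have hmin := Nat.find_spec hne
  have hmin' : ∀ y ∈ S, Nat.find hne ≤ y := fun y hy => Nat.find_min' hne hy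
  -- Take `x` minimal in `S`, so that `x ≤ y ≤ m / 3` and `c * y ≡ x` modulo `m` with `c = 2`, `-1`
  -- or `-2`. The size of `c * y - x` leaves almost no choice for the quotient `q`.
  obtain ⟨y, hy, hdvd⟩ := hiter j _ hmin
  set x := Nat.find hne with hx
  have hxm := hle x hmin
  have hym := hle y hy
  have hxy := hmin' y hy
  have key : ∀ c : ℤ, (m : ℤ) ∣ 4 ^ j - c → (m : ℤ) ∣ c * y - x := fun c hc => by
    have : c * y - x = (4 ^ j * y - x) - (4 ^ j - c) * y := by ring
    rw [this]
    exact dvd_sub hdvd (hc.mul_right _)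
  suffices x = 0 by rwa [← this]
  rcases hj with h | h | h
  · obtain ⟨q, hq⟩ := key 2 h
    have hq0 : q = 0 := by
      have h1 : q < 1 := by nlinarith
      have h2 : -1 < q := by nlinarith
      omega
    rw [hq0] at hq
    omega
  · obtain ⟨q, hq⟩ := key (-1) (by simpa using h)
    have hq0 : q = 0 := by
      have h1 : q < 1 := by nlinarith
      have h2 : -1 < q := by nlinarith
      omega
    rw [hq0] at hq
    omega
  · obtain ⟨q, hq⟩ := key (-2) (by simpa using h)
    have hq0 : q = 0 ∨ q = -1 := by
      have h1 : q < 1 := by nlinarith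
      have h2 : -2 < q := by nlinarith
      omega
    rcases hq0 with hq0 | hq0 <;> rw [hq0] at hq
    · omega
    -- Here `2 * y + x = m`, which forces `x = y = m / 3`. Only this case needs `3 ∤ m`.
    · exact absurd ⟨x, by omega⟩ h3

/-! ### Exponentials in `L²` of a probability measure on the unit interval -/

open BoundedContinuousFunction in
/-- The bounded continuous function equal to `2 π i x` on the unit interval. -/
def clampedPhase : BoundedContinuousFunction ℝ ℂ :=
  ofNormedAddCommGroup (fun x : ℝ => 2 * Real.pi * Complex.I * ((max 0 (min x 1) : ℝ) : ℂ))
    (by fun_prop) (2 * Real.pi) fun x => by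
      have h0 : (0 : ℝ) ≤ max 0 (min x 1) := le_max_left _ _
      have h1 : max 0 (min x 1) ≤ (1 : ℝ) := max_le zero_le_one (min_le_right _ _)
      have hpi := Real.pi_pos
      rw [norm_mul, norm_mul, norm_mul, Complex.norm_I, Complex.norm_real, Complex.norm_real,
        Complex.norm_ofNat, Real.norm_of_nonneg hpi.le, Real.norm_of_nonneg h0]
      nlinarith

/-- A bounded continuous function equal to `e_t` on the unit interval. -/
def clampedExp (t : ℝ) : BoundedContinuousFunction ℝ ℂ := NormedSpace.exp (t • clampedPhase)

lemma clampedExp_apply (t : ℝ) {x : ℝ} (hx : x ∈ Set.Icc (0 : ℝ) 1) :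
    clampedExp t x = expFun t x := by
  -- Evaluation at `x` is a continuous ring homomorphism and hence commutes with the exponential
  -- series.
  let ev : BoundedContinuousFunction ℝ ℂ →+* ℂ :=
    { toFun := fun f => f x
      map_one' := rfl
      map_mul' := fun _ _ => rfl
      map_zero' := rfl
      map_add' := fun _ _ => rfl }
  have hev : Continuous ev := (BoundedContinuousFunction.evalCLM ℂ x).continuous
  have h := NormedSpace.map_exp ev hev (t • clampedPhase)
  have h2 : clampedExp t x = ev (NormedSpace.exp (t • clampedPhase)) := rfl
  rw [h2, h, ← Complex.exp_eq_exp_ℂ, expFun]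
  congr 1
  change (t : ℝ) • (2 * Real.pi * Complex.I * ((max 0 (min x 1) : ℝ) : ℂ)) = _
  rw [min_eq_left hx.2, max_eq_right hx.1, Complex.real_smul]
  ring

variable (ν : Measure ℝ) [IsProbabilityMeasure ν]

/-- The class of `e_t` in `L²(ν)`, for a measure `ν` carried by the unit interval. -/
def expLp (t : ℝ) : Lp ℂ 2 ν := BoundedContinuousFunction.toLp 2 ν ℂ (clampedExp t)

variable {ν}

lemma coeFn_expLp (hν : ∀ᵐ x ∂ν, x ∈ Set.Icc (0 : ℝ) 1) (t : ℝ) :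
    expLp ν t =ᵐ[ν] expFun t := by
  filter_upwards [BoundedContinuousFunction.coeFn_toLp 2 ν ℂ (clampedExp t), hν] with x h1 h2
  rw [expLp, h1, clampedExp_apply t h2]

/-- Smoothness `⊤` means real analyticity. It holds because `clampedExp` is the exponential of a
Banach algebra along a line; this is why the phase was clamped to a bounded function. -/
lemma contDiff_expLp : ContDiff ℝ ⊤ (expLp ν) := by
  have h1 : ContDiff ℝ ⊤ clampedExp := by
    rw [contDiff_omega_iff_analyticOnNhd]
    intro t _
    have h := NormedSpace.exp_analytic (𝕂 := ℝ) (t • clampedPhase)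
    have h2 : AnalyticAt ℝ (fun s : ℝ => s • clampedPhase) t :=
      analyticAt_id.smul analyticAt_const
    exact AnalyticAt.fun_comp (g := NormedSpace.exp) h h2
  exact ((BoundedContinuousFunction.toLp 2 ν ℂ).restrictScalars ℝ).contDiff.comp h1

lemma inner_expLp (hν : ∀ᵐ x ∂ν, x ∈ Set.Icc (0 : ℝ) 1) (s t : ℝ) :
    inner ℂ (expLp ν s) (expLp ν t) = charFun ν (2 * Real.pi * (t - s)) := by
  rw [L2.inner_def, charFun_apply_real]
  refine integral_congr_ae ?_
  filter_upwards [coeFn_expLp hν s, coeFn_expLp hν t] with x h1 h2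
  rw [h1, h2, RCLike.inner_apply, expFun, expFun, ← Complex.exp_conj, ← Complex.exp_add]
  congr 1
  simp only [map_mul, Complex.conj_I, Complex.conj_ofReal, map_ofNat]
  push_cast
  ring

lemma norm_expLp (hν : ∀ᵐ x ∂ν, x ∈ Set.Icc (0 : ℝ) 1) (t : ℝ) : ‖expLp ν t‖ = 1 := by
  have h := inner_expLp hν t t
  rw [sub_self, mul_zero, charFun_zero, probReal_univ, inner_self_eq_norm_sq_to_K] at h
  have h' : ‖expLp ν t‖ ^ 2 = 1 := Complex.ofReal_injective (by push_cast; exact h)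
  exact (pow_eq_one_iff_of_nonneg (norm_nonneg _) two_ne_zero).1 h'

instance : Fact ((0 : ℝ) < 2) := ⟨two_pos⟩

/-- Pull a continuous function on the circle of length `2` back to the line, and take its class. -/
def circleToLp (ν : Measure ℝ) [IsProbabilityMeasure ν] (f : C(AddCircle (2 : ℝ), ℂ)) : Lp ℂ 2 ν :=
  BoundedContinuousFunction.toLp 2 ν ℂ ((BoundedContinuousFunction.mkOfCompact f).compContinuous
    ⟨fun x : ℝ => (x : AddCircle (2 : ℝ)), AddCircle.continuous_mk' 2⟩)

lemma continuous_circleToLp : Continuous (circleToLp ν) :=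
  (BoundedContinuousFunction.toLp 2 ν ℂ).continuous.comp
    ((BoundedContinuousFunction.continuous_compContinuous _).comp
      (ContinuousMap.isometryEquivBoundedOfCompact _ _).continuous)

lemma circleToLp_add (f g : C(AddCircle (2 : ℝ), ℂ)) :
    circleToLp ν (f + g) = circleToLp ν f + circleToLp ν g := by
  rw [circleToLp, circleToLp, circleToLp, ← map_add]
  rfl

lemma circleToLp_smul (c : ℂ) (f : C(AddCircle (2 : ℝ), ℂ)) :
    circleToLp ν (c • f) = c • circleToLp ν f := by
  rw [circleToLp, circleToLp, ← map_smul]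
  rfl

lemma circleToLp_fourier (hν : ∀ᵐ x ∂ν, x ∈ Set.Icc (0 : ℝ) 1) (n : ℤ) :
    circleToLp ν (fourier n) = expLp ν (n / 2) := by
  apply Lp.ext
  filter_upwards [coeFn_expLp hν (n / 2), BoundedContinuousFunction.coeFn_toLp 2 ν ℂ
    ((BoundedContinuousFunction.mkOfCompact (fourier n : C(AddCircle (2 : ℝ), ℂ))).compContinuous
    ⟨fun x : ℝ => (x : AddCircle (2 : ℝ)), AddCircle.continuous_mk' 2⟩)] with x h1 h2
  rw [h1, circleToLp, h2]
  change fourier n (x : AddCircle (2 : ℝ)) = _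
  rw [fourier_coe_apply, expFun]
  congr 1
  push_cast
  ring

/-- The exponentials `e_t` are total in `L²(ν)`. -/
lemma eq_top_of_expLp_mem (hν : ∀ᵐ x ∂ν, x ∈ Set.Icc (0 : ℝ) 1) {M : Submodule ℂ (Lp ℂ 2 ν)}
    (hM : IsClosed (M : Set (Lp ℂ 2 ν))) (h : ∀ t, expLp ν t ∈ M) : M = ⊤ := by
  have hspan : ∀ f ∈ Submodule.span ℂ (Set.range (@fourier (2 : ℝ))), circleToLp ν f ∈ M := by
    intro f hf
    induction hf using Submodule.span_induction with
    | mem f hf =>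
      obtain ⟨n, rfl⟩ := hf
      rw [circleToLp_fourier hν]
      exact h _
    | zero =>
      have : circleToLp ν 0 = 0 := by simpa using circleToLp_smul (ν := ν) 0 0
      rw [this]
      exact M.zero_mem
    | add f g _ _ hf hg => rw [circleToLp_add]; exact M.add_mem hf hg
    | smul c f _ hf => rw [circleToLp_smul]; exact M.smul_mem c hf
  have hall : ∀ f, circleToLp ν f ∈ M := by
    intro f
    have hf : f ∈ (Submodule.span ℂ (Set.range (@fourier (2 : ℝ)))).topologicalClosure := by
      rw [span_fourier_closure_eq_top]; trivial
    exact closure_minimal (t := circleToLp ν ⁻¹' M) hspan (hM.preimage continuous_circleToLp) hf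
  have hbcf : ∀ g : BoundedContinuousFunction ℝ ℂ,
      BoundedContinuousFunction.toLp 2 ν ℂ g ∈ M := by
    intro g
    -- The period is `2` rather than `1` so that the even reflection of `g` from `[0, 1]` to `[-1,
    -- 1]` has equal end values and descends to the circle.
    let f : C(AddCircle (2 : ℝ), ℂ) := ⟨AddCircle.liftIco 2 (-1) (fun x => g |x|),
      AddCircle.liftIco_continuous (by norm_num)
        (g.continuous.comp continuous_abs).continuousOn⟩
    have : circleToLp ν f = BoundedContinuousFunction.toLp 2 ν ℂ g := by
      apply Lp.ext
      rw [circleToLp]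
      refine (BoundedContinuousFunction.coeFn_toLp 2 ν ℂ _).trans
        (Filter.EventuallyEq.trans ?_ (BoundedContinuousFunction.coeFn_toLp 2 ν ℂ g).symm)
      filter_upwards [hν] with x hx
      change AddCircle.liftIco 2 (-1) (fun x => g |x|) (x : AddCircle (2 : ℝ)) = g x
      rcases hx.2.lt_or_eq with hlt | rfl
      · rw [AddCircle.liftIco_coe_apply ⟨by linarith [hx.1], by linarith⟩, abs_of_nonneg hx.1]
      · have h1 : ((1 : ℝ) : AddCircle (2 : ℝ)) = ((-1 : ℝ) : AddCircle (2 : ℝ)) := by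
          rw [← AddCircle.coe_add_period 2 (-1)]; norm_num
        rw [h1, AddCircle.liftIco_coe_apply ⟨le_rfl, by norm_num⟩, abs_neg, abs_one]
    rw [← this]
    exact hall f
  refine Submodule.eq_top_iff'.2 fun x => ?_
  have hd := BoundedContinuousFunction.toLp_denseRange (p := 2) ℂ ν ℂ (by simp) x
  exact closure_minimal (Set.range_subset_iff.2 hbcf) hM hd

/-! ### The Cantor measure and its characteristic function -/

lemma ae_mem_Icc_cantorMeasure : ∀ᵐ x ∂cantorMeasure, x ∈ Set.Icc (0 : ℝ) 1 := by
  refine (ae_map_iff (p := (· ∈ Set.Icc (0 : ℝ) 1)) measurable_expansion.aemeasurable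
    measurableSet_Icc).2 ?_
  refine Filter.Eventually.of_forall fun ω => ?_
  have hg := hasSum_geometric_of_lt_one (r := (1 / 4 : ℝ)) (by norm_num) (by norm_num)
  have hg' := hg.mul_left (1 / 2 : ℝ)
  refine ⟨tsum_nonneg fun k => div_nonneg (digit_nonneg _) (by positivity), ?_⟩
  have h : expansion ω ≤ 1 / 2 * (1 - 1 / 4)⁻¹ := by
    refine hasSum_le (fun k => ?_) (summable_expansion ω).hasSum hg'
    have h4 : (0 : ℝ) < 4 ^ k := by positivity
    rw [div_pow, one_pow, pow_succ, div_le_iff₀ (by positivity)]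
    have := digit_le (ω k)
    field_simp
    linarith
  exact h.trans (by norm_num)

/-- The factor `(1 + e^{iθ})/2` of the self-similarity equation equals `e^{iθ/2} cos(θ/2)`, here
with `θ = πt`; its phase disappears in the modulus. -/
lemma norm_sq_charFun_cantorMeasure (t : ℝ) :
    ‖charFun cantorMeasure (2 * Real.pi * t)‖ ^ 2 =
      Real.cos (Real.pi * t / 2) ^ 2 * ‖charFun cantorMeasure (2 * Real.pi * (t / 4))‖ ^ 2 := by
  rw [isInvariant_cantorMeasure.charFun_eq, norm_mul, mul_pow,
    show 2 * Real.pi * t / 4 = 2 * Real.pi * (t / 4) by ring]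
  congr 1
  have h : (1 + Complex.exp ((2 * Real.pi * t / 2 : ℝ) * Complex.I)) / 2 =
      Complex.exp ((Real.pi * t / 2 : ℝ) * Complex.I) * (Real.cos (Real.pi * t / 2) : ℝ) := by
    rw [Complex.ofReal_cos, Complex.cos, mul_div_assoc', mul_add, ← Complex.exp_add,
      ← Complex.exp_add, add_comm (1 : ℂ)]
    congr 2
    · congr 1; push_cast; ring
    · rw [← Complex.exp_zero]; congr 1; push_cast; ring
  rw [h, norm_mul, Complex.norm_exp_ofReal_mul_I, one_mul, Complex.norm_real, Real.norm_eq_abs,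
    sq_abs]

lemma charFun_cantorMeasure_eq_zero_of_odd {k : ℤ} (hk : Odd k) :
    charFun cantorMeasure (2 * Real.pi * k) = 0 := by
  have h := norm_sq_charFun_cantorMeasure (k : ℝ)
  obtain ⟨q, rfl⟩ := hk
  have hc : Real.cos (Real.pi * ((2 * q + 1 : ℤ) : ℝ) / 2) = 0 := by
    rw [Real.cos_eq_zero_iff]
    exact ⟨q, by push_cast; ring⟩
  rw [hc] at h
  simpa using h

lemma charFun_cantorMeasure_four_mul {t : ℝ} (h : charFun cantorMeasure (2 * Real.pi * t) = 0) :
    charFun cantorMeasure (2 * Real.pi * (4 * t)) = 0 := by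
  have h' := norm_sq_charFun_cantorMeasure (4 * t)
  rw [mul_div_cancel_left₀ t (by norm_num), h] at h'
  simpa using h'

/-! ### The set of frequencies -/

section Frequencies

variable {m : ℕ}

lemma zero_mem_spectrumSet : (0 : ℝ) ∈ spectrumSet m :=
  ⟨0, fun _ => 0, fun _ => Or.inl rfl, by simp⟩

lemma mem_spectrumSet_iff {x : ℝ} :
    x ∈ spectrumSet m ↔ ∃ γ ∈ spectrumSet m, x = 4 * γ ∨ x = 4 * γ + m := by
  constructor
  · rintro ⟨n, l, hl, rfl⟩
    refine ⟨∑ k ∈ Finset.range n, 4 ^ k * l (k + 1), ?_, ?_⟩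
    · cases n with
      | zero => simpa using zero_mem_spectrumSet
      | succ n => exact ⟨n, fun k => l (k + 1), fun k => hl _, rfl⟩
    · have h : ∑ k ∈ Finset.range (n + 1), 4 ^ k * l k =
          4 * ∑ k ∈ Finset.range n, 4 ^ k * l (k + 1) + l 0 := by
        rw [Finset.sum_range_succ', Finset.mul_sum, pow_zero, one_mul]
        congr 1
        exact Finset.sum_congr rfl fun k _ => by ring
      rw [h]
      rcases hl 0 with h0 | h0 <;> simp [h0]
  · rintro ⟨γ, ⟨n, l, hl, rfl⟩, hx⟩
    have key : ∀ a : ℝ, (a = 0 ∨ a = m) →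
        4 * (∑ k ∈ Finset.range (n + 1), 4 ^ k * l k) + a ∈ spectrumSet m := by
      intro a ha
      refine ⟨n + 1, fun k => Nat.casesOn k a l, fun k => ?_, ?_⟩
      · cases k with
        | zero => exact ha
        | succ k => exact hl k
      · rw [Finset.sum_range_succ' _ (n + 1), Finset.mul_sum, pow_zero, one_mul]
        congr 1
        exact Finset.sum_congr rfl fun k _ => by ring
    rcases hx with rfl | rfl
    · simpa using key 0 (Or.inl rfl)
    · exact key m (Or.inr rfl)

lemma four_mul_mem_spectrumSet {γ : ℝ} (h : γ ∈ spectrumSet m) : 4 * γ ∈ spectrumSet m :=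
  mem_spectrumSet_iff.2 ⟨γ, h, Or.inl rfl⟩

lemma four_mul_add_mem_spectrumSet {γ : ℝ} (h : γ ∈ spectrumSet m) : 4 * γ + m ∈ spectrumSet m :=
  mem_spectrumSet_iff.2 ⟨γ, h, Or.inr rfl⟩

lemma exists_natCast_of_mem_spectrumSet {γ : ℝ} (h : γ ∈ spectrumSet m) : ∃ k : ℕ, γ = k := by
  obtain ⟨n, l, hl, rfl⟩ := h
  have : ∀ k, ∃ a : ℕ, l k = a := fun k => (hl k).elim (fun h => ⟨0, by simpa using h⟩)
    fun h => ⟨m, h⟩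
  choose a ha using this
  exact ⟨∑ k ∈ Finset.range (n + 1), 4 ^ k * a k, by push_cast; simp [ha]⟩

/-- If the lowest digits differ, `γ - γ'` is an odd integer, a zero of the transform. If they agree,
removing them divides the difference by `4`, and zeros are stable under multiplication by `4`. The
descent ends because distinct integers are at least `1` apart. -/
lemma charFun_sub_eq_zero_of_mem_spectrumSet (hm : Odd m) {γ γ' : ℝ} (hγ : γ ∈ spectrumSet m)
    (hγ' : γ' ∈ spectrumSet m) (hne : γ ≠ γ') :
    charFun cantorMeasure (2 * Real.pi * (γ - γ')) = 0 := by
  have key : ∀ (n : ℕ), ∀ γ ∈ spectrumSet m, ∀ γ' ∈ spectrumSet m, γ ≠ γ' → |γ - γ'| < 4 ^ n →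
      charFun cantorMeasure (2 * Real.pi * (γ - γ')) = 0 := by
    intro n
    induction n with
    | zero =>
      intro γ hγ γ' hγ' hne hlt
      obtain ⟨k, rfl⟩ := exists_natCast_of_mem_spectrumSet hγ
      obtain ⟨k', rfl⟩ := exists_natCast_of_mem_spectrumSet hγ'
      have h : |(k : ℤ) - k'| < 1 := by
        have : |((k : ℤ) : ℝ) - ((k' : ℤ) : ℝ)| < 1 := by simpa using hlt
        exact_mod_cast this
      rw [Int.abs_lt_one_iff, sub_eq_zero] at h
      exact absurd (by exact_mod_cast h) hne
    | succ n ih =>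
      intro γ hγ γ' hγ' hne hlt
      obtain ⟨δ, hδ, h⟩ := mem_spectrumSet_iff.1 hγ
      obtain ⟨δ', hδ', h'⟩ := mem_spectrumSet_iff.1 hγ'
      have hsame : γ - γ' = 4 * (δ - δ') →
          charFun cantorMeasure (2 * Real.pi * (γ - γ')) = 0 := by
        intro hd
        rw [hd]
        refine charFun_cantorMeasure_four_mul (ih δ hδ δ' hδ' ?_ ?_)
        · rintro rfl
          exact hne (sub_eq_zero.1 (by simpa using hd))
        · rw [hd, abs_mul, abs_of_pos (four_pos : (0 : ℝ) < 4), pow_succ] at hlt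
          linarith
      obtain ⟨k, hk⟩ := exists_natCast_of_mem_spectrumSet hδ
      obtain ⟨k', hk'⟩ := exists_natCast_of_mem_spectrumSet hδ'
      obtain ⟨q, hq⟩ := hm
      rcases h with h | h <;> rcases h' with h' | h'
      · exact hsame (by rw [h, h']; ring)
      · have : γ - γ' = ((4 * k - 4 * k' - m : ℤ) : ℝ) := by
          rw [h, h', hk, hk']; push_cast; ring
        rw [this]
        exact charFun_cantorMeasure_eq_zero_of_odd ⟨2 * k - 2 * k' - q - 1, by omega⟩
      · have : γ - γ' = ((4 * k - 4 * k' + m : ℤ) : ℝ) := by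
          rw [h, h', hk, hk']; push_cast; ring
        rw [this]
        exact charFun_cantorMeasure_eq_zero_of_odd ⟨2 * k - 2 * k' + q, by omega⟩
      · exact hsame (by rw [h, h']; ring)
  obtain ⟨n, hn⟩ := pow_unbounded_of_one_lt |γ - γ'| (by norm_num : (1 : ℝ) < 4)
  exact key n γ hγ γ' hγ' hne hn

/-- Split off the lowest digit of a frequency. -/
def spectrumSetSumEquiv (hm : Odd m) : spectrumSet m ⊕ spectrumSet m ≃ spectrumSet m :=
  Equiv.ofBijective
    (Sum.elim (fun γ => ⟨4 * γ, four_mul_mem_spectrumSet γ.2⟩)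
      (fun γ => ⟨4 * γ + m, four_mul_add_mem_spectrumSet γ.2⟩)) (by
    have hdisj : ∀ γ γ' : spectrumSet m, 4 * (γ : ℝ) ≠ 4 * γ' + m := by
      intro γ γ' h
      obtain ⟨k, hk⟩ := exists_natCast_of_mem_spectrumSet γ.2
      obtain ⟨k', hk'⟩ := exists_natCast_of_mem_spectrumSet γ'.2
      rw [hk, hk'] at h
      have h' : 4 * k = 4 * k' + m := by exact_mod_cast h
      obtain ⟨q, hq⟩ := hm
      omega
    constructor
    · rintro (γ | γ) (γ' | γ') h <;> have h' := congrArg Subtype.val h <;>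
        simp only [Sum.elim_inl, Sum.elim_inr] at h'
      · exact congrArg _ (Subtype.ext (by linarith))
      · exact absurd h' (hdisj _ _)
      · exact absurd h'.symm (hdisj _ _)
      · exact congrArg _ (Subtype.ext (by linarith))
    · rintro ⟨x, hx⟩
      obtain ⟨γ, hγ, rfl | rfl⟩ := mem_spectrumSet_iff.1 hx
      · exact ⟨Sum.inl ⟨γ, hγ⟩, rfl⟩
      · exact ⟨Sum.inr ⟨γ, hγ⟩, rfl⟩)

end Frequencies

/-! ### Bessel's inequality with equality on the closed span -/

section Projection

variable {E ι : Type*} [NormedAddCommGroup E] [InnerProductSpace ℂ E] [CompleteSpace E]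

/-- An orthonormal family is a Hilbert basis of its closed span, so this is Parseval's identity
there: `x` and its projection have the same inner products with each `v i`. -/
lemma hasSum_norm_sq_inner_starProjection {v : ι → E} (hv : Orthonormal ℂ v) (x : E) :
    HasSum (fun i => ‖inner ℂ (v i) x‖ ^ 2)
      (‖(Submodule.span ℂ (Set.range v)).topologicalClosure.starProjection x‖ ^ 2) := by
  set M := (Submodule.span ℂ (Set.range v)).topologicalClosure with hM
  have hle : Submodule.span ℂ (Set.range v) ≤ M := Submodule.le_topologicalClosure _
  have hmem : ∀ i, v i ∈ M := fun i => hle (Submodule.subset_span ⟨i, rfl⟩)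
  have : CompleteSpace M := (Submodule.isClosed_topologicalClosure _).completeSpace_coe
  let w : ι → M := fun i => ⟨v i, hmem i⟩
  have hw : Orthonormal ℂ w := by
    refine ⟨fun i => hv.1 i, fun i j hij => hv.2 hij⟩
  have hbot : (Submodule.span ℂ (Set.range w))ᗮ = ⊥ := by
    rw [Submodule.eq_bot_iff]
    intro y hy
    have h1 : ∀ z ∈ M, inner ℂ z (y : E) = 0 := by
      have hcl : IsClosed {z : E | inner ℂ z (y : E) = 0} :=
        isClosed_eq (by fun_prop) continuous_const
      refine fun z hz => closure_minimal (fun z hz => ?_) hcl hz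
      change inner ℂ z (y : E) = 0
      induction hz using Submodule.span_induction with
      | mem z hz =>
        obtain ⟨i, rfl⟩ := hz
        exact Submodule.inner_right_of_mem_orthogonal (u := w i)
          (Submodule.subset_span (Set.mem_range_self i)) hy
      | zero => exact inner_zero_left _
      | add a b _ _ ha hb => rw [inner_add_left, ha, hb, add_zero]
      | smul c a _ ha => rw [inner_smul_left, ha, mul_zero]
    exact Subtype.ext (inner_self_eq_zero.1 (h1 y y.2))
  let b := HilbertBasis.mkOfOrthogonalEqBot hw hbot
  have hb : ∀ i, b i = w i := fun i => by
    simp only [b, HilbertBasis.coe_mkOfOrthogonalEqBot]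
  have hinner : ∀ i, inner ℂ (v i) x = inner ℂ (b i) (M.orthogonalProjectionOnto x) := fun i => by
    rw [hb, Submodule.inner_orthogonalProjectionOnto_eq_of_mem_left]
  have hs := b.hasSum_inner_mul_inner (M.orthogonalProjectionOnto x) (M.orthogonalProjectionOnto x)
  have hn : ‖M.starProjection x‖ = ‖M.orthogonalProjectionOnto x‖ := rfl
  have hf : (fun i => inner ℂ (M.orthogonalProjectionOnto x) (b i) *
      inner ℂ (b i) (M.orthogonalProjectionOnto x)) =
      fun i => ((‖inner ℂ (v i) x‖ ^ 2 : ℝ) : ℂ) := by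
    funext i
    rw [hinner, ← inner_conj_symm (M.orthogonalProjectionOnto x), Complex.conj_mul']
    push_cast; rfl
  rw [hf, inner_self_eq_norm_sq_to_K] at hs
  rw [hn, ← Complex.hasSum_ofReal]
  push_cast at hs ⊢
  exact hs

end Projection

/-! ### Harmonic functions of the transfer operator -/

section Transfer

variable {m : ℕ} {H : ℝ → ℝ}

/-- If the points of `[0, m / 3]` where a harmonic function takes its minimum on this interval are
finite in number, then `0` is one of them. -/
lemma zero_mem_of_finite_minimizers (hm : Odd m) (h3 : ¬ 3 ∣ m)
    (hj : ∃ j : ℕ, (m : ℤ) ∣ 4 ^ j - 2 ∨ (m : ℤ) ∣ 4 ^ j + 1 ∨ (m : ℤ) ∣ 4 ^ j + 2)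
    (hR : ∀ t, H t = Real.cos (Real.pi * t / 2) ^ 2 * H (t / 4) +
      Real.sin (Real.pi * t / 2) ^ 2 * H ((t + m) / 4)) {c : ℝ}
    (hc : ∀ t ∈ Set.Icc (0 : ℝ) (m / 3), c ≤ H t)
    (hfin : {t ∈ Set.Icc (0 : ℝ) (m / 3) | H t = c}.Finite)
    (hne : {t ∈ Set.Icc (0 : ℝ) (m / 3) | H t = c}.Nonempty) : H 0 = c := by
  set F := {t ∈ Set.Icc (0 : ℝ) (m / 3) | H t = c} with hF
  have hmpos : (0 : ℝ) < m := by exact_mod_cast hm.pos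
  have hI0 : ∀ t ∈ Set.Icc (0 : ℝ) (m / 3), t / 4 ∈ Set.Icc (0 : ℝ) (m / 3) :=
    fun t ht => ⟨by linarith [ht.1], by linarith [ht.1, ht.2]⟩
  have hI1 : ∀ t ∈ Set.Icc (0 : ℝ) (m / 3), (t + m) / 4 ∈ Set.Icc (0 : ℝ) (m / 3) :=
    fun t ht => ⟨by linarith [ht.1], by linarith [ht.1, ht.2]⟩
  -- The weights `cos²` and `sin²` sum to `1`, so the minimum `c` is a weighted mean of two values
  -- that are at least `c`; each weighted excess vanishes.
  have hsplit : ∀ t ∈ F, Real.cos (Real.pi * t / 2) ^ 2 * (H (t / 4) - c) = 0 ∧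
      Real.sin (Real.pi * t / 2) ^ 2 * (H ((t + m) / 4) - c) = 0 := by
    intro t ht
    have h1 := mul_nonneg (sq_nonneg (Real.cos (Real.pi * t / 2)))
      (sub_nonneg.2 (hc _ (hI0 t ht.1)))
    have h2 := mul_nonneg (sq_nonneg (Real.sin (Real.pi * t / 2)))
      (sub_nonneg.2 (hc _ (hI1 t ht.1)))
    have h4 := hR t
    have h5 : Real.cos (Real.pi * t / 2) ^ 2 * (H (t / 4) - c) +
        Real.sin (Real.pi * t / 2) ^ 2 * (H ((t + m) / 4) - c) = 0 := by
      rw [ht.2] at h4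
      linear_combination -h4 - c * Real.sin_sq_add_cos_sq (Real.pi * t / 2)
    exact ⟨by linarith, by linarith⟩
  have hchild0 : ∀ t ∈ F, Real.cos (Real.pi * t / 2) ≠ 0 → t / 4 ∈ F := fun t ht h =>
    ⟨hI0 t ht.1, sub_eq_zero.1 ((mul_eq_zero.1 (hsplit t ht).1).resolve_left (pow_ne_zero 2 h))⟩
  have hchild1 : ∀ t ∈ F, Real.sin (Real.pi * t / 2) ≠ 0 → (t + m) / 4 ∈ F := fun t ht h =>
    ⟨hI1 t ht.1, sub_eq_zero.1 ((mul_eq_zero.1 (hsplit t ht).2).resolve_left (pow_ne_zero 2 h))⟩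
  have hex : ∀ t : F, ∃ s : F, 4 * (s : ℝ) = t ∨ 4 * (s : ℝ) = t + m := by
    intro t
    by_cases h : Real.cos (Real.pi * t / 2) = 0
    · have hs : Real.sin (Real.pi * t / 2) ≠ 0 := fun hs => by
        have := Real.sin_sq_add_cos_sq (Real.pi * t / 2)
        rw [h, hs] at this
        norm_num at this
      exact ⟨⟨_, hchild1 t t.2 hs⟩, Or.inr (by dsimp only; ring)⟩
    · exact ⟨⟨_, hchild0 t t.2 h⟩, Or.inl (by dsimp only; ring)⟩
  -- The images of `[0, m / 3]` under the two maps are disjoint, as `t = t' + m` is impossible for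
  -- `t ≤ m / 3`. So `f` is injective, hence onto the finite set `F`, and `f t` is the only child of
  -- `t` in `F`.
  have hparent : ∀ t t' : F, ∀ s : ℝ, (4 * s = t ∨ 4 * s = t + m) →
      (4 * s = t' ∨ 4 * s = t' + m) → t = t' := by
    intro t t' s h h'
    have ht := t.2.1
    have ht' := t'.2.1
    apply Subtype.ext
    rcases h with h | h <;> rcases h' with h' | h' <;>
      linarith [ht.1, ht.2, ht'.1, ht'.2]
  choose f hf using hex
  have : Finite F := hfin
  have hsurj : Function.Surjective f := Finite.surjective_of_injective fun t t' h =>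
    hparent t t' (f t) (hf t) (h ▸ hf t')
  have huniq : ∀ (t s : F), (4 * (s : ℝ) = t ∨ 4 * (s : ℝ) = t + m) → s = f t := by
    intro t s hs
    obtain ⟨t', rfl⟩ := hsurj s
    rw [hparent t t' _ hs (hf t')]
  have hnat : ∀ t ∈ F, ∃ k : ℕ, t = k := by
    intro t ht
    -- If both weights were nonzero, both children would lie in `F` and coincide, although they
    -- differ by `m / 4`.
    have hsc : Real.sin (Real.pi * t) = 0 := by
      rw [show Real.pi * t = 2 * (Real.pi * t / 2) by ring, Real.sin_two_mul]
      by_contra h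
      have hs : Real.sin (Real.pi * t / 2) ≠ 0 := fun hs => h (by rw [hs]; ring)
      have hcs : Real.cos (Real.pi * t / 2) ≠ 0 := fun hcs => h (by rw [hcs]; ring)
      have h0 := huniq ⟨t, ht⟩ ⟨_, hchild0 t ht hcs⟩ (Or.inl (by dsimp only; ring))
      have h1 := huniq ⟨t, ht⟩ ⟨_, hchild1 t ht hs⟩ (Or.inr (by dsimp only; ring))
      have := congrArg Subtype.val (h0.trans h1.symm)
      dsimp only at this
      linarith
    obtain ⟨k, hk⟩ := Real.sin_eq_zero_iff.1 hsc
    have hkt : t = k := by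
      have := Real.pi_pos.ne'
      apply mul_left_cancel₀ this
      linarith
    have hk0 : 0 ≤ k := by
      have := ht.1.1
      rw [hkt] at this
      exact_mod_cast this
    lift k to ℕ using hk0
    exact ⟨k, by simpa using hkt⟩
  have hmem : (0 : ℕ) ∈ {k : ℕ | (k : ℝ) ∈ F} := by
    refine zero_mem_of_successors h3 hj ?_ ?_ ?_
    · obtain ⟨t, ht⟩ := hne
      obtain ⟨k, rfl⟩ := hnat t ht
      exact ⟨k, ht⟩
    · intro k hk
      have := hk.1.2
      have h' : (3 : ℝ) * k ≤ m := by linarith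
      exact_mod_cast h'
    · intro k hk
      obtain ⟨l, hl⟩ := hnat _ (f ⟨k, hk⟩).2
      refine ⟨l, ?_, ?_⟩
      · change (l : ℝ) ∈ F
        rw [← hl]; exact (f ⟨k, hk⟩).2
      · have := hf ⟨k, hk⟩
        rw [hl] at this
        dsimp only at this
        exact_mod_cast this
  have h0 : ((0 : ℕ) : ℝ) ∈ F := hmem
  simpa using h0.2

/-- An analytic harmonic function that attains its maximum at `0` is constant. -/
lemma eq_of_harmonic (hm : Odd m) (h3 : ¬ 3 ∣ m)
    (hj : ∃ j : ℕ, (m : ℤ) ∣ 4 ^ j - 2 ∨ (m : ℤ) ∣ 4 ^ j + 1 ∨ (m : ℤ) ∣ 4 ^ j + 2)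
    (hH : ContDiff ℝ ⊤ H) (hle : ∀ t, H t ≤ H 0)
    (hR : ∀ t, H t = Real.cos (Real.pi * t / 2) ^ 2 * H (t / 4) +
      Real.sin (Real.pi * t / 2) ^ 2 * H ((t + m) / 4)) (t : ℝ) : H t = H 0 := by
  have hmpos : (0 : ℝ) < m := by exact_mod_cast hm.pos
  obtain ⟨x, hx, hmin⟩ := (isCompact_Icc (a := (0 : ℝ)) (b := m / 3)).exists_isMinOn
    ⟨0, le_rfl, by positivity⟩ hH.continuous.continuousOn
  have hmin' : ∀ s ∈ Set.Icc (0 : ℝ) (m / 3), H x ≤ H s := fun s hs => hmin hs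
  have hinf : {s ∈ Set.Icc (0 : ℝ) (m / 3) | H s = H x}.Infinite := by
    intro hfin
    -- Now `H 0` is both the maximum and the minimum on `[0, m / 3]`, so every point of this
    -- infinite interval is a minimizer.
    have h0 := zero_mem_of_finite_minimizers hm h3 hj hR hmin' hfin ⟨x, hx, rfl⟩
    refine (Set.Icc_infinite (show (0 : ℝ) < m / 3 by positivity)) (hfin.subset fun s hs => ?_)
    exact ⟨hs, le_antisymm (h0 ▸ hle s) (hmin' s hs)⟩
  obtain ⟨z, -, hz⟩ := hinf.exists_accPt_of_subset_isCompact isCompact_Icc (Set.sep_subset _ _)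
  have hfreq : ∃ᶠ s in nhdsWithin z {z}ᶜ, H s = H x :=
    (accPt_iff_frequently_nhdsNE.1 hz).mono fun s hs => hs.2
  have hconst := AnalyticOnNhd.eq_of_frequently_eq (contDiff_omega_iff_analyticOnNhd.1 hH)
    (analyticOnNhd_const (v := H x)) hfreq
  rw [hconst]

end Transfer

/-! ### Completeness -/

section Completeness

variable {m : ℕ}

lemma orthonormal_expLp (hm : Odd m) :
    Orthonormal ℂ (fun γ : spectrumSet m => expLp cantorMeasure (γ : ℝ)) := by
  refine ⟨fun γ => norm_expLp ae_mem_Icc_cantorMeasure _, fun γ γ' h => ?_⟩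
  change inner ℂ (expLp cantorMeasure (γ : ℝ)) (expLp cantorMeasure (γ' : ℝ)) = 0
  rw [inner_expLp ae_mem_Icc_cantorMeasure]
  exact charFun_sub_eq_zero_of_mem_spectrumSet hm γ'.2 γ.2 fun h' => h (Subtype.ext h'.symm)

/-- The closed span of the exponentials with frequencies in `Γ(m)`. -/
def spectrumSpan (m : ℕ) : Submodule ℂ (Lp ℂ 2 cantorMeasure) :=
  (Submodule.span ℂ (Set.range fun γ : spectrumSet m =>
    expLp cantorMeasure (γ : ℝ))).topologicalClosure

instance : CompleteSpace (spectrumSpan m) :=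
  (Submodule.isClosed_topologicalClosure _).completeSpace_coe

/-- The squared norm of the projection of `e_{-t}` to the closed span of the exponentials with
frequencies in `Γ(m)`. -/
def projNormSq (m : ℕ) (t : ℝ) : ℝ :=
  ‖(spectrumSpan m).starProjection (expLp cantorMeasure (-t))‖ ^ 2

/-- The sign in `e_{-t}` produces `t + γ` instead of `t - γ`, so the maps of the transfer operator
become `t / 4` and `(t + m) / 4`, which preserve `[0, m / 3]`. -/
lemma hasSum_projNormSq (hm : Odd m) (t : ℝ) :
    HasSum (fun γ : spectrumSet m => ‖charFun cantorMeasure (2 * Real.pi * (t + γ))‖ ^ 2)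
      (projNormSq m t) := by
  have h := hasSum_norm_sq_inner_starProjection (orthonormal_expLp hm) (expLp cantorMeasure (-t))
  refine Eq.subst (motive := fun f => HasSum f _) (funext fun γ => ?_) h
  rw [inner_expLp ae_mem_Icc_cantorMeasure, ← RCLike.norm_conj, ← charFun_neg]
  congr 3
  ring

/-- Splitting off the lowest digit of the frequency, a shift of `t` by `4γ` moves `πt/2` by a
multiple of `2π`, while the further shift by the odd `m` turns `cos²` into `sin²`. -/
lemma projNormSq_eq (hm : Odd m) (t : ℝ) :
    projNormSq m t = Real.cos (Real.pi * t / 2) ^ 2 * projNormSq m (t / 4) +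
      Real.sin (Real.pi * t / 2) ^ 2 * projNormSq m ((t + m) / 4) := by
  refine (hasSum_projNormSq hm t).unique ?_
  rw [← (spectrumSetSumEquiv hm).hasSum_iff]
  refine HasSum.sum ?_ ?_
  · refine Eq.subst (motive := fun f => HasSum f _) (funext fun γ => ?_)
      ((hasSum_projNormSq hm (t / 4)).mul_left (Real.cos (Real.pi * t / 2) ^ 2))
    symm
    change ‖charFun cantorMeasure (2 * Real.pi * (t + 4 * γ))‖ ^ 2 = _
    rw [norm_sq_charFun_cantorMeasure, show (t + 4 * (γ : ℝ)) / 4 = t / 4 + γ by ring]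
    obtain ⟨k, hk⟩ := exists_natCast_of_mem_spectrumSet γ.2
    rw [hk, show Real.pi * (t + 4 * k) / 2 = Real.pi * t / 2 + k * (2 * Real.pi) by ring,
      Real.cos_add_nat_mul_two_pi]
  · refine Eq.subst (motive := fun f => HasSum f _) (funext fun γ => ?_)
      ((hasSum_projNormSq hm ((t + m) / 4)).mul_left (Real.sin (Real.pi * t / 2) ^ 2))
    symm
    change ‖charFun cantorMeasure (2 * Real.pi * (t + (4 * γ + m)))‖ ^ 2 = _
    rw [norm_sq_charFun_cantorMeasure,
      show (t + (4 * (γ : ℝ) + m)) / 4 = (t + m) / 4 + γ by ring]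
    obtain ⟨k, hk⟩ := exists_natCast_of_mem_spectrumSet γ.2
    obtain ⟨q, hq⟩ := hm
    congr 1
    rw [hk, hq, show Real.pi * (t + (4 * k + ((2 * q + 1 : ℕ) : ℝ))) / 2 =
      (Real.pi * t / 2 + Real.pi / 2 + q * Real.pi) + k * (2 * Real.pi) by push_cast; ring,
      Real.cos_add_nat_mul_two_pi, Real.cos_add_nat_mul_pi, Real.cos_add_pi_div_two, mul_pow,
      neg_sq, ← pow_mul, mul_comm q 2, pow_mul, neg_one_sq, one_pow, one_mul]

lemma contDiff_projNormSq : ContDiff ℝ ⊤ (projNormSq m) := by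
  have h1 : ContDiff ℝ ⊤ fun t : ℝ => expLp cantorMeasure (-t) := contDiff_expLp.comp contDiff_neg
  exact (((spectrumSpan m).starProjection.restrictScalars ℝ).contDiff.comp h1).norm_sq ℂ

/-- An odd number `m` prime to `3` is complete if some power of `4` is congruent to `2`, `-1` or
`-2` modulo `m`. -/
theorem isCompleteNumber_of_four_pow_modEq (hm : Odd m) (h3 : ¬ 3 ∣ m)
    (hj : ∃ j : ℕ, (m : ℤ) ∣ 4 ^ j - 2 ∨ (m : ℤ) ∣ 4 ^ j + 1 ∨ (m : ℤ) ∣ 4 ^ j + 2) :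
    IsCompleteNumber m := by
  have hν := ae_mem_Icc_cantorMeasure
  have hsub : ∀ γ : spectrumSet m, expLp cantorMeasure (γ : ℝ) ∈ spectrumSpan m := fun γ =>
    Submodule.le_topologicalClosure _ (Submodule.subset_span ⟨γ, rfl⟩)
  have h0 : projNormSq m 0 = 1 := by
    have := hsub ⟨0, zero_mem_spectrumSet⟩
    rw [projNormSq, neg_zero, Submodule.starProjection_eq_self_iff.2 this, norm_expLp hν, one_pow]
  have hle : ∀ t, projNormSq m t ≤ projNormSq m 0 := fun t => by
    rw [h0, projNormSq]
    have := (spectrumSpan m).norm_starProjection_apply_le (expLp cantorMeasure (-t))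
    rw [norm_expLp hν] at this
    exact pow_le_one₀ (norm_nonneg _) this
  have hmem : ∀ t, expLp cantorMeasure t ∈ spectrumSpan m := fun t => by
    -- A vector whose projection has the same norm as itself lies in the subspace.
    have h := eq_of_harmonic hm h3 hj contDiff_projNormSq hle (projNormSq_eq hm) (-t)
    rw [h0, projNormSq, neg_neg, pow_eq_one_iff_of_nonneg (norm_nonneg _) two_ne_zero] at h
    rw [Submodule.mem_iff_norm_starProjection, h, norm_expLp hν]
  have htop : spectrumSpan m = ⊤ :=
    eq_top_of_expLp_mem hν (Submodule.isClosed_topologicalClosure _) hmem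
  have hdense : ⊤ ≤ (Submodule.span ℂ (Set.range fun γ : spectrumSet m =>
      expLp cantorMeasure (γ : ℝ))).topologicalClosure := htop.ge
  refine ⟨hm, HilbertBasis.mk (orthonormal_expLp hm) hdense, fun γ => ?_⟩
  rw [HilbertBasis.coe_mk]
  exact coeFn_expLp hν _

end Completeness

end CantorSpectra

end

theorem theorem2p8 (p : ℕ) (hp : p.Prime) (hp3 : 3 < p) (n : ℕ) :
    CantorSpectra.IsCompleteNumber (p ^ n) := by
  refine CantorSpectra.isCompleteNumber_of_four_pow_modEq ?_ ?_
    (CantorSpectra.exists_four_pow_modEq hp (by omega) n)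
  · exact (hp.odd_of_ne_two (by omega)).pow
  · intro h
    have := (Nat.prime_dvd_prime_iff_eq Nat.prime_three hp).1 (Nat.prime_three.dvd_of_dvd_pow h)
    omega
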